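/- Let $n\ge 2$ and $p\ge 2$, let $M^n$ be a smooth manifold and let $f:M^n\to\mathbb{R}^{n+p}$ be a smooth immersion; endow $M$ with the induced metric $\langle\cdot,\cdot\rangle$, so that $f$ is an isometric immersion. Let $\alpha$ be its second fundamental form, $\mathcal H=\frac1n\operatorname{tr}\alpha$ its mean curvature vector field, and $\nabla^\perp$, $R^\perp$ its normal connection and the curvature tensor of $\nabla^\perp$. Let $\rho\ge 0$ be given by $$\rho^2=\frac{n}{n-1}\bigl(\|\alpha\|^2-n\|\mathcal H\|^2\bigr),\qquad \|\alpha\|^2=\sum_{i,j=1}^n\|\alpha(X_i,X_j)\|^2$$ for any orthonormal basis $X_1,\dots,X_n$ of the tangent space. Suppose that: 1. $f$ is umbilic-free, i.e. at no point of $M$ does $\alpha=\langle\cdot,\cdot\rangle\mathcal H$ hold (equivalently, $\rho>0$ everywhere). Then $\langle\cdot,\cdot\rangle^*=\rho^2\langle\cdot,\cdot\rangle$ is a Riemannian metric on $M$, the Moebius metric of $f$; let $R^*$ be its curvature tensor, and let $\beta=\rho\,(\alpha-\mathcal H\langle\cdot,\cdot\rangle)$ be the Moebius second fundamental form. 2.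 $f$ has flat normal bundle, i.e. $R^\perp=0$. 3. $\beta$ is semi-parallel, i.e. for all tangent vectors $X,Y,Z,W$ at any point of $M$, $$R^\perp(X,Y)\beta(Z,W)-\beta(R^*(X,Y)Z,W)-\beta(Z,R^*(X,Y)W)=0 .$$ 4. $f$ has $n$ distinct principal normal vector fields: there are normal vector fields $\eta_1,\dots,\eta_n$, pairwise distinct at every point, such that for every $i$ and every $x\in M$ there is a nonzero $X\in T_xM$ with $\alpha(X,Y)=\langle X,Y\rangle\,\eta_i(x)$ for all $Y\in T_xM$. Then the Moebius metric $\langle\cdot,\cdot\rangle^*$ of $f$ has vanishing sectional curvature at every point of $M$ and along every tangent plane. -/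

import Mathlib

open scoped Manifold ContDiff

noncomputable section

/-- The Euclidean space `ℝ^k` with its standard inner product. -/
abbrev Euc (k : ℕ) : Type := EuclideanSpace ℝ (Fin k)

/-! ### Riemannian metrics on an open subset of `ℝ^n`

A metric is given by its values `G y u v` on vectors `u`, `v` at the point `y`. -/

namespace CoordMetric

variable {n : ℕ}

/-- The coordinate vector `∂/∂x_i`. -/
def coordVec (i : Fin n) : Euc n := EuclideanSpace.single i (1 : ℝ)

/-- The matrix `g_{ij}` of the metric in the coordinate frame. -/
def gram (G : Euc n → Euc n → Euc n → ℝ) (y : Euc n) : Matrix (Fin n) (Fin n) ℝ :=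
  Matrix.of fun i j => G y (coordVec i) (coordVec j)

/-- The entries `g^{ij}` of the inverse matrix. -/
def gramInv (G : Euc n → Euc n → Euc n → ℝ) (y : Euc n) (i j : Fin n) : ℝ :=
  (gram G y)⁻¹ i j

/-- Christoffel symbol of the first kind,
`½ (∂_u G(v, w) + ∂_v G(u, w) - ∂_w G(u, v))` for constant vectors `u`, `v`, `w`. -/
def christoffelFirst (G : Euc n → Euc n → Euc n → ℝ) (y u v w : Euc n) : ℝ :=
  (1 / 2) * (fderiv ℝ (fun z => G z v w) y u + fderiv ℝ (fun z => G z u w) y v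
    - fderiv ℝ (fun z => G z u v) y w)

/-- Christoffel symbol of the second kind, `Γ(u, v) = ∑ g^{kl} Γ(u, v; ∂_l) ∂_k`. -/
def christoffel (G : Euc n → Euc n → Euc n → ℝ) (y u v : Euc n) : Euc n :=
  ∑ k, ∑ l, (gramInv G y k l * christoffelFirst G y u v (coordVec l)) • coordVec k

/-- The Levi-Civita connection `∇_X Y` of the metric `G` on vector fields. -/
def leviCivita (G : Euc n → Euc n → Euc n → ℝ) (X Y : Euc n → Euc n) (y : Euc n) : Euc n :=
  fderiv ℝ Y y (X y) + christoffel G y (X y) (Y y)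

/-- `R(X, Y) Z = ∇_X ∇_Y Z - ∇_Y ∇_X Z - ∇_{[X, Y]} Z` on vector fields. -/
def curvatureField (G : Euc n → Euc n → Euc n → ℝ) (X Y Z : Euc n → Euc n) (y : Euc n) :
    Euc n :=
  leviCivita G X (leviCivita G Y Z) y - leviCivita G Y (leviCivita G X Z) y
    - leviCivita G (VectorField.lieBracket ℝ X Y) Z y

/-- The curvature tensor at `y`: the vectors are extended to constant vector fields. -/
def curvature (G : Euc n → Euc n → Euc n → ℝ) (y u v w : Euc n) : Euc n :=
  curvatureField G (fun _ => u) (fun _ => v) (fun _ => w) y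

/-- The sectional curvature at `y` of the plane spanned by the independent vectors `u`, `v`. -/
def sectional (G : Euc n → Euc n → Euc n → ℝ) (y u v : Euc n) : ℝ :=
  G y (curvature G y u v v) u / (G y u u * G y v v - G y u v ^ 2)

end CoordMetric

/-! ### Immersions of an open subset of `ℝ^n` into `ℝ^m` -/

namespace ParamImmersion

open CoordMetric

variable {n m : ℕ}

/-- The induced metric (first fundamental form). -/
def metric (F : Euc n → Euc m) (y u v : Euc n) : ℝ :=
  inner ℝ (fderiv ℝ F y u) (fderiv ℝ F y v)

/-- The normal space: the orthogonal complement of the image of the differential. -/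
def normalSpace (F : Euc n → Euc m) (y : Euc n) : Submodule ℝ (Euc m) :=
  (LinearMap.range (fderiv ℝ F y).toLinearMap)ᗮ

/-- The orthogonal projection onto the normal space. -/
def normalProj (F : Euc n → Euc m) (y : Euc n) : Euc m →L[ℝ] Euc m :=
  (normalSpace F y).starProjection

/-- The normal connection `∇^⊥_X ξ`: the normal part of the derivative of `ξ` along `X`. -/
def normalConnection (F : Euc n → Euc m) (X : Euc n → Euc n) (ξ : Euc n → Euc m)
    (y : Euc n) : Euc m :=
  normalProj F y (fderiv ℝ ξ y (X y))

/-- `R^⊥(X, Y) ξ = ∇^⊥_X ∇^⊥_Y ξ - ∇^⊥_Y ∇^⊥_X ξ - ∇^⊥_{[X, Y]} ξ` on fields. -/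
def normalCurvatureField (F : Euc n → Euc m) (X Y : Euc n → Euc n) (ξ : Euc n → Euc m)
    (y : Euc n) : Euc m :=
  normalConnection F X (normalConnection F Y ξ) y
    - normalConnection F Y (normalConnection F X ξ) y
    - normalConnection F (VectorField.lieBracket ℝ X Y) ξ y

/-- The normal curvature tensor at `y`, for a normal vector `ξ` at `y`: the tangent vectors are
extended to constant fields, and `ξ` to the normal field given by its normal projections. -/
def normalCurvature (F : Euc n → Euc m) (y u v : Euc n) (ξ : Euc m) : Euc m :=
  normalCurvatureField F (fun _ => u) (fun _ => v) (fun z => normalProj F z ξ) y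

/-- The second fundamental form `α(u, v)`: by the Gauss formula, the normal part of the derivative
along `u` of the image under the differential of the constant field `v`. -/
def sff (F : Euc n → Euc m) (y u v : Euc n) : Euc m :=
  normalProj F y (fderiv ℝ (fun z => fderiv ℝ F z v) y u)

/-- The mean curvature vector `H = (1/n) tr α`, the trace being taken with the induced metric. -/
def meanCurvature (F : Euc n → Euc m) (y : Euc n) : Euc m :=
  (1 / (n : ℝ)) • ∑ i, ∑ j, gramInv (metric F) y i j • sff F y (coordVec i) (coordVec j)

/-- The squared norm `‖α‖²` with respect to the induced metric, i.e. the sum of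
`‖α(X_i, X_j)‖²` over any orthonormal basis, written in the coordinate frame. -/
def sffNormSq (F : Euc n → Euc m) (y : Euc n) : ℝ :=
  ∑ i, ∑ j, ∑ k, ∑ l, gramInv (metric F) y i k * gramInv (metric F) y j l *
    inner ℝ (sff F y (coordVec i) (coordVec j)) (sff F y (coordVec k) (coordVec l))

/-- The function `ρ ≥ 0` with `ρ² = n/(n-1) (‖α‖² - n ‖H‖²)`. -/
def rho (F : Euc n → Euc m) (y : Euc n) : ℝ :=
  Real.sqrt ((n : ℝ) / ((n : ℝ) - 1) * (sffNormSq F y - n * ‖meanCurvature F y‖ ^ 2))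

/-- The Moebius metric `ρ² ⟨·, ·⟩`. -/
def moebiusMetric (F : Euc n → Euc m) (y u v : Euc n) : ℝ :=
  rho F y ^ 2 * metric F y u v

/-- The Moebius second fundamental form `β = ρ (α - H ⟨·, ·⟩)`. -/
def moebiusSff (F : Euc n → Euc m) (y u v : Euc n) : Euc m :=
  rho F y • (sff F y u v - metric F y u v • meanCurvature F y)

end ParamImmersion

/-! ### Immersions of an `n`-manifold into `ℝ^m`

The tensors at a point `x` are computed in the chart of `M` at `x`; this is also the chart through
which the tangent space at `x` is identified with `ℝ^n`. -/

namespace MoebiusSubmanifold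

open ParamImmersion

variable {n m : ℕ} {M : Type*} [TopologicalSpace M] [ChartedSpace (Euc n) M]

/-- The map `f` read in the chart of `M` at `x`. -/
def localRep (f : M → Euc m) (x : M) : Euc n → Euc m :=
  f ∘ (extChartAt (𝓡 n) x).symm

/-- The coordinates of the point `x` in the chart at `x`. -/
def center (x : M) : Euc n := extChartAt (𝓡 n) x x

/-- A smooth immersion; `M` is then considered with the induced metric. -/
def IsSmoothImmersion (f : M → Euc m) : Prop :=
  ContMDiff (𝓡 n) (𝓡 m) ∞ f ∧ ∀ x, Function.Injective (mfderiv (𝓡 n) (𝓡 m) f x)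

/-- The normal space `N_f M (x)`. -/
def normalSpaceAt (f : M → Euc m) (x : M) : Submodule ℝ (Euc m) :=
  normalSpace (localRep (n := n) f x) (center x)

/-- The induced metric of `f` at `x`. -/
def inducedMetric (f : M → Euc m) (x : M) (u v : TangentSpace (𝓡 n) x) : ℝ :=
  metric (localRep (n := n) f x) (center x) u v

/-- The second fundamental form `α` of `f` at `x`. -/
def secondFundamentalForm (f : M → Euc m) (x : M) (u v : TangentSpace (𝓡 n) x) : Euc m :=
  sff (localRep (n := n) f x) (center x) u v

/-- The mean curvature vector of `f` at `x`. -/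
def meanCurvatureVector (f : M → Euc m) (x : M) : Euc m :=
  meanCurvature (localRep (n := n) f x) (center x)

/-- The normal curvature tensor `R^⊥(u, v) ξ` of `f` at `x`. -/
def normalCurvatureTensor (f : M → Euc m) (x : M) (u v : TangentSpace (𝓡 n) x) (ξ : Euc m) :
    Euc m :=
  normalCurvature (localRep (n := n) f x) (center x) u v ξ

/-- The Moebius second fundamental form `β` of `f` at `x`. -/
def moebiusSecondFundamentalForm (f : M → Euc m) (x : M) (u v : TangentSpace (𝓡 n) x) : Euc m :=
  moebiusSff (localRep (n := n) f x) (center x) u v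

/-- The curvature tensor `R^*(u, v) w` of the Moebius metric of `f` at `x`. -/
def moebiusCurvature (f : M → Euc m) (x : M) (u v w : TangentSpace (𝓡 n) x) :
    TangentSpace (𝓡 n) x :=
  CoordMetric.curvature (moebiusMetric (localRep (n := n) f x)) (center x) u v w

/-- The sectional curvature `K^*(u, v)` of the Moebius metric of `f` at `x`. -/
def moebiusSectionalCurvature (f : M → Euc m) (x : M) (u v : TangentSpace (𝓡 n) x) : ℝ :=
  CoordMetric.sectional (moebiusMetric (localRep (n := n) f x)) (center x) u v

/-- `f` has no umbilical point, i.e. `α = ⟨·, ·⟩ H` holds at no point. -/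
def UmbilicFree (n : ℕ) {m : ℕ} {M : Type*} [TopologicalSpace M] [ChartedSpace (Euc n) M]
    (f : M → Euc m) : Prop :=
  ∀ x, ¬ ∀ u v : TangentSpace (𝓡 n) x,
    secondFundamentalForm f x u v = inducedMetric f x u v • meanCurvatureVector (n := n) f x

/-- The normal bundle of `f` is flat: `R^⊥ = 0`. -/
def HasFlatNormalBundle (n : ℕ) {m : ℕ} {M : Type*} [TopologicalSpace M]
    [ChartedSpace (Euc n) M] (f : M → Euc m) : Prop :=
  ∀ x, ∀ u v : TangentSpace (𝓡 n) x, ∀ ξ ∈ normalSpaceAt (n := n) f x,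
    normalCurvatureTensor f x u v ξ = 0

/-- The Moebius second fundamental form is semi-parallel:
`R^⊥(X, Y) β(Z, W) - β(R^*(X, Y) Z, W) - β(Z, R^*(X, Y) W) = 0`. -/
def IsMoebiusSemiParallel (n : ℕ) {m : ℕ} {M : Type*} [TopologicalSpace M]
    [ChartedSpace (Euc n) M] (f : M → Euc m) : Prop :=
  ∀ x, ∀ u v z w : TangentSpace (𝓡 n) x,
    normalCurvatureTensor f x u v (moebiusSecondFundamentalForm f x z w)
      - moebiusSecondFundamentalForm f x (moebiusCurvature f x u v z) w
      - moebiusSecondFundamentalForm f x z (moebiusCurvature f x u v w) = 0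

/-- `η` is a principal normal of `f` at `x`: a normal vector with
`E_η = {u | α(u, v) = ⟨u, v⟩ η for all v}` different from zero. -/
def IsPrincipalNormal (n : ℕ) {m : ℕ} {M : Type*} [TopologicalSpace M]
    [ChartedSpace (Euc n) M] (f : M → Euc m) (x : M) (η : Euc m) : Prop :=
  η ∈ normalSpaceAt (n := n) f x ∧ ∃ u : TangentSpace (𝓡 n) x, u ≠ 0 ∧
    ∀ v : TangentSpace (𝓡 n) x, secondFundamentalForm f x u v = inducedMetric f x u v • η

/-- `f` has `k` principal normal vector fields `η_1, …, η_k` that are pairwise distinct at every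
point.  No regularity of the fields is required. -/
def HasDistinctPrincipalNormals (n : ℕ) {m : ℕ} {M : Type*} [TopologicalSpace M]
    [ChartedSpace (Euc n) M] (f : M → Euc m) (k : ℕ) : Prop :=
  ∃ η : Fin k → M → Euc m, (∀ i x, IsPrincipalNormal n f x (η i x)) ∧
    ∀ x i j, i ≠ j → η i x ≠ η j x

/-- All sectional curvatures of the Moebius metric vanish. -/
def HasVanishingMoebiusCurvature (n : ℕ) {m : ℕ} {M : Type*} [TopologicalSpace M]
    [ChartedSpace (Euc n) M] (f : M → Euc m) : Prop :=
  ∀ x, ∀ u v : TangentSpace (𝓡 n) x, LinearIndependent ℝ ![u, v] →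
    moebiusSectionalCurvature f x u v = 0

end MoebiusSubmanifold

end

/-!
The theorem is pointwise linear algebra, once the curvature tensor `R*` of the Moebius metric is
known to be skew.

Fix `x`. By symmetry of `α`, principal vectors `Xᵢ`, `Xⱼ` of distinct principal normals satisfy
`⟨Xᵢ, Xⱼ⟩ (ηᵢ - ηⱼ) = 0`, so the `n` principal normals provide an orthonormal frame with
`α(Xᵢ, Xⱼ) = δᵢⱼ ηᵢ` (`exists_orthonormal_principal`). As the normal bundle is flat, semi-parallelism
says that each `A = R*(u, v)` satisfies `β(A Xᵢ, Xⱼ) + β(Xᵢ, A Xⱼ) = 0`. Since `A` is skew for the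
Moebius metric, hence for the conformal induced metric, this reads `ρ ⟨A Xᵢ, Xⱼ⟩ (ηⱼ - ηᵢ) = 0`, and
therefore `A = 0` (`metric_eq_zero_of_skew_of_derivation`).

Skewness of the curvature (`curvature_skew`) is derived for any `C²` metric in coordinates from
metric compatibility of the Levi-Civita connection and the symmetry of second derivatives. To apply
it to the Moebius metric one needs that `ρ²⟨·, ·⟩` is nondegenerate and smooth at the point: in an
orthonormal frame `‖α‖² - n ‖H‖²` is the squared norm of `α - ⟨·, ·⟩ H`, so `ρ > 0` away from umbilics
(`rho_pos`), and there the square root defining `ρ` is smooth (`contDiffAt_moebiusMetric`).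
-/

open scoped Manifold ContDiff

noncomputable section

/-! ### Curvature of a metric in coordinates -/

namespace CoordMetric

variable {n : ℕ}

/-- The metric whose value at each point is a given bilinear form. -/
abbrev ofForm (B : Euc n → LinearMap.BilinForm ℝ (Euc n)) : Euc n → Euc n → Euc n → ℝ :=
  fun z u v => B z u v

theorem sum_smul_coordVec (v : Euc n) : ∑ k, v k • coordVec k = v := by
  ext i
  simp [coordVec, Finset.sum_apply, Pi.single_apply]

theorem apply_eq_sum {V : Type*} [AddCommGroup V] [Module ℝ V] (L : Euc n →ₗ[ℝ] V) (v : Euc n) :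
    L v = ∑ k, v k • L (coordVec k) := by
  conv_lhs => rw [← sum_smul_coordVec v]
  simp

theorem bilin_eq_sum (b : LinearMap.BilinForm ℝ (Euc n)) (v w : Euc n) :
    b v w = ∑ k, v k * b (coordVec k) w := by
  rw [apply_eq_sum b v]
  simp

theorem fderiv_ofForm_left {B : Euc n → LinearMap.BilinForm ℝ (Euc n)} {y : Euc n}
    (hd : ∀ v w, DifferentiableAt ℝ (fun z => B z v w) y) (u v w : Euc n) :
    fderiv ℝ (fun z => B z v w) y u
      = ∑ k, v k * fderiv ℝ (fun z => B z (coordVec k) w) y u := by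
  have h : (fun z => B z v w) = fun z => ∑ k, v k * B z (coordVec k) w := by
    funext z
    exact bilin_eq_sum _ _ _
  rw [h, fderiv_fun_sum fun k _ => (hd _ _).const_mul _]
  simp [fderiv_const_mul (hd _ _)]

theorem fderiv_ofForm_right {B : Euc n → LinearMap.BilinForm ℝ (Euc n)} {y : Euc n}
    (hd : ∀ v w, DifferentiableAt ℝ (fun z => B z v w) y) (u v w : Euc n) :
    fderiv ℝ (fun z => B z v w) y u
      = ∑ k, w k * fderiv ℝ (fun z => B z v (coordVec k)) y u :=
  fderiv_ofForm_left (B := fun z => (B z).flip) (fun v w => hd w v) u w v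

/-- The product rule for the pairing of a moving vector with a constant one. -/
theorem fderiv_ofForm_moving {B : Euc n → LinearMap.BilinForm ℝ (Euc n)} {y : Euc n}
    (hd : ∀ v w, DifferentiableAt ℝ (fun z => B z v w) y) {A : Euc n → Euc n}
    (hA : DifferentiableAt ℝ A y) (u w : Euc n) :
    fderiv ℝ (fun z => B z (A z) w) y u
      = fderiv ℝ (fun z => B z (A y) w) y u + B y (fderiv ℝ A y u) w := by
  have h : (fun z => B z (A z) w) = fun z => ∑ k, A z k * B z (coordVec k) w := by
    funext z
    exact bilin_eq_sum _ _ _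
  have hAk : ∀ k, HasFDerivAt (fun z => A z k)
      ((EuclideanSpace.proj k : Euc n →L[ℝ] ℝ).comp (fderiv ℝ A y)) y := fun k =>
    (EuclideanSpace.proj k : Euc n →L[ℝ] ℝ).hasFDerivAt.comp y hA.hasFDerivAt
  have h2 := HasFDerivAt.fun_sum (u := Finset.univ) fun k _ =>
    (hAk k).fun_mul (hd (coordVec k) w).hasFDerivAt
  rw [h, h2.fderiv, fderiv_ofForm_left hd, bilin_eq_sum (B y) (fderiv ℝ A y u),
    ← Finset.sum_add_distrib]
  simp [mul_comm]

theorem christoffelFirst_eq_sum {B : Euc n → LinearMap.BilinForm ℝ (Euc n)} {y : Euc n}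
    (hd : ∀ v w, DifferentiableAt ℝ (fun z => B z v w) y) (u v w : Euc n) :
    christoffelFirst (ofForm B) y u v w
      = ∑ k, w k * christoffelFirst (ofForm B) y u v (coordVec k) := by
  have h : fderiv ℝ (fun z => B z u v) y w
      = ∑ k, w k * fderiv ℝ (fun z => B z u v) y (coordVec k) := by
    simpa using apply_eq_sum (fderiv ℝ (fun z => B z u v) y).toLinearMap w
  simp only [christoffelFirst]
  rw [fderiv_ofForm_right hd u v w, fderiv_ofForm_right hd v u w, h, ← Finset.sum_add_distrib,
    ← Finset.sum_sub_distrib, Finset.mul_sum]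
  exact Finset.sum_congr rfl fun k _ => by ring

/-- Lowering the index of the second Christoffel symbol gives the first one. -/
theorem ofForm_christoffel {B : Euc n → LinearMap.BilinForm ℝ (Euc n)} {y : Euc n}
    (hd : ∀ v w, DifferentiableAt ℝ (fun z => B z v w) y) (hs : ∀ v w, B y v w = B y w v)
    (hdet : (gram (ofForm B) y).det ≠ 0) (u v w : Euc n) :
    B y (christoffel (ofForm B) y u v) w = christoffelFirst (ofForm B) y u v w := by
  have hmul : ∀ m l, ∑ k, B y (coordVec k) (coordVec m) * gramInv (ofForm B) y k l
      = if m = l then 1 else 0 := by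
    intro m l
    have h := congrFun (congrFun (Matrix.mul_nonsing_inv _ (isUnit_iff_ne_zero.2 hdet)) m) l
    rw [Matrix.mul_apply, Matrix.one_apply] at h
    rw [← h]
    exact Finset.sum_congr rfl fun k _ => by rw [hs]; rfl
  have hbasis : ∀ m, B y (christoffel (ofForm B) y u v) (coordVec m)
      = christoffelFirst (ofForm B) y u v (coordVec m) := by
    intro m
    simp only [christoffel, map_sum, map_smul, LinearMap.sum_apply, LinearMap.smul_apply,
      smul_eq_mul]
    rw [Finset.sum_comm]
    calc _ = ∑ l, (if m = l then 1 else 0) * christoffelFirst (ofForm B) y u v (coordVec l) := by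
          refine Finset.sum_congr rfl fun l _ => ?_
          rw [← hmul m l, Finset.sum_mul]
          exact Finset.sum_congr rfl fun k _ => by ring
      _ = _ := by simp
  rw [christoffelFirst_eq_sum hd, apply_eq_sum (B y _) w]
  simp [hbasis]

theorem christoffelFirst_add_swap {B : Euc n → LinearMap.BilinForm ℝ (Euc n)}
    (hs : ∀ z v w, B z v w = B z w v) (y u v w : Euc n) :
    christoffelFirst (ofForm B) y u v w + christoffelFirst (ofForm B) y u w v
      = fderiv ℝ (fun z => B z v w) y u := by
  have h : (fun z => B z w v) = fun z => B z v w := by funext z; exact hs z w v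
  simp only [christoffelFirst, ofForm, h]
  ring

/-- The Levi-Civita connection is compatible with the metric. -/
theorem fderiv_ofForm_eq_christoffel {B : Euc n → LinearMap.BilinForm ℝ (Euc n)} {y : Euc n}
    (hd : ∀ v w, DifferentiableAt ℝ (fun z => B z v w) y) (hs : ∀ z v w, B z v w = B z w v)
    (hdet : (gram (ofForm B) y).det ≠ 0) (u v w : Euc n) :
    fderiv ℝ (fun z => B z v w) y u = B y (christoffel (ofForm B) y u v) w
      + B y v (christoffel (ofForm B) y u w) := by
  rw [hs y v, ofForm_christoffel hd (hs y) hdet, ofForm_christoffel hd (hs y) hdet,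
    christoffelFirst_add_swap hs]

theorem contDiffAt_gram_det {G : Euc n → Euc n → Euc n → ℝ} {y : Euc n} {r : WithTop ℕ∞}
    (hG : ∀ v w, ContDiffAt ℝ r (fun z => G z v w) y) :
    ContDiffAt ℝ r (fun z => (gram G z).det) y := by
  simp only [Matrix.det_apply, Units.smul_def]
  refine ContDiffAt.sum fun σ _ => ContDiffAt.const_smul _ (contDiffAt_prod fun i _ => ?_)
  exact hG _ _

theorem contDiffAt_gramInv {G : Euc n → Euc n → Euc n → ℝ} {y : Euc n} {r : WithTop ℕ∞}
    (hG : ∀ v w, ContDiffAt ℝ r (fun z => G z v w) y) (hdet : (gram G y).det ≠ 0) (i j : Fin n) :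
    ContDiffAt ℝ r (fun z => gramInv G z i j) y := by
  simp only [gramInv, Matrix.inv_def, Matrix.smul_apply, Ring.inverse_eq_inv', smul_eq_mul]
  refine ((contDiffAt_gram_det hG).inv hdet).mul ?_
  simp only [Matrix.adjugate_apply, Matrix.det_apply, Units.smul_def]
  refine ContDiffAt.sum fun σ _ => ContDiffAt.const_smul _ (contDiffAt_prod fun k _ => ?_)
  simp only [Matrix.updateRow_apply]
  split_ifs
  · exact contDiffAt_const
  · exact hG _ _

theorem differentiableAt_fderiv_apply {E V : Type*} [NormedAddCommGroup E] [NormedSpace ℝ E]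
    [NormedAddCommGroup V] [NormedSpace ℝ V] {φ : E → V} {y : E} (h : ContDiffAt ℝ 2 φ y) (u : E) :
    DifferentiableAt ℝ (fun z => fderiv ℝ φ z u) y :=
  ((h.fderiv_right (m := 1) (by norm_num)).differentiableAt one_ne_zero).clm_apply
    (differentiableAt_const u)

theorem differentiableAt_christoffel {G : Euc n → Euc n → Euc n → ℝ} {y : Euc n}
    (hG : ∀ v w, ContDiffAt ℝ 2 (fun z => G z v w) y) (hdet : (gram G y).det ≠ 0) (u v : Euc n) :
    DifferentiableAt ℝ (fun z => christoffel G z u v) y := by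
  refine DifferentiableAt.fun_sum fun k _ => DifferentiableAt.fun_sum fun l _ => ?_
  refine DifferentiableAt.smul_const (DifferentiableAt.mul ?_ ?_) _
  · exact (contDiffAt_gramInv hG hdet k l).differentiableAt two_ne_zero
  · exact (((differentiableAt_fderiv_apply (hG _ _) _).add
      (differentiableAt_fderiv_apply (hG _ _) _)).sub
      (differentiableAt_fderiv_apply (hG _ _) _)).const_mul _

/-- The curvature tensor in terms of the Christoffel symbols: for constant fields the bracket term
and the derivatives of the fields drop out. -/
theorem curvature_eq {G : Euc n → Euc n → Euc n → ℝ} (y u v w : Euc n)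
    (h0 : christoffel G y 0 w = 0) :
    curvature G y u v w
      = (fderiv ℝ (fun z => christoffel G z v w) y u + christoffel G y u (christoffel G y v w))
        - (fderiv ℝ (fun z => christoffel G z u w) y v
          + christoffel G y v (christoffel G y u w)) := by
  have hc : ∀ a : Euc n, leviCivita G (fun _ => a) (fun _ => w)
      = fun z => christoffel G z a w := by
    intro a
    funext z
    simp [leviCivita]
  simp only [curvature, curvatureField, hc]
  simp [leviCivita, VectorField.lieBracket, h0]

theorem christoffel_zero_left {B : Euc n → LinearMap.BilinForm ℝ (Euc n)} (y w : Euc n) :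
    christoffel (ofForm B) y 0 w = 0 := by
  simp [christoffel, christoffelFirst, ofForm]

/-- The curvature endomorphism `R(u, v)` is skew with respect to the metric. -/
theorem curvature_skew {B : Euc n → LinearMap.BilinForm ℝ (Euc n)} {y : Euc n}
    (hB : ∀ v w, ContDiffAt ℝ 2 (fun z => B z v w) y) (hs : ∀ z v w, B z v w = B z w v)
    (hdet : (gram (ofForm B) y).det ≠ 0) (u v w t : Euc n) :
    B y (curvature (ofForm B) y u v w) t = -B y (curvature (ofForm B) y u v t) w := by
  have hd : ∀ v w, DifferentiableAt ℝ (fun z => B z v w) y := fun v w =>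
    (hB v w).differentiableAt two_ne_zero
  have hdet' : ∀ᶠ z in nhds y, (gram (ofForm B) z).det ≠ 0 :=
    (contDiffAt_gram_det (G := ofForm B) hB).continuousAt.eventually_ne hdet
  -- Only finitely many coordinate entries have to be differentiable near `y`, which makes the
  -- neighbourhood independent of the vectors.
  have hd' : ∀ᶠ z in nhds y, ∀ v w, DifferentiableAt ℝ (fun z => B z v w) z := by
    have h : ∀ᶠ z in nhds y, ∀ i j,
        DifferentiableAt ℝ (fun z => B z (coordVec i) (coordVec j)) z := by
      refine Filter.eventually_all.2 fun i => Filter.eventually_all.2 fun j => ?_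
      exact ((hB (coordVec i) (coordVec j)).eventually (by simp)).mono
        fun z hz => hz.differentiableAt two_ne_zero
    refine h.mono fun z hz v w => ?_
    have : (fun z => B z v w)
        = fun z => ∑ i, v i * ∑ j, w j * B z (coordVec i) (coordVec j) := by
      funext z
      rw [bilin_eq_sum]
      refine Finset.sum_congr rfl fun i _ => ?_
      rw [apply_eq_sum (B z (coordVec i)) w]
      simp
    rw [this]
    exact DifferentiableAt.fun_sum fun i _ => (DifferentiableAt.fun_sum fun j _ =>
      (hz i j).const_mul _).const_mul _
  -- Differentiating `⟨Γ(b, w), t⟩` along `a` by metric compatibility.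
  have key : ∀ a b w t : Euc n,
      B y (fderiv ℝ (fun z => christoffel (ofForm B) z b w) y a
        + christoffel (ofForm B) y a (christoffel (ofForm B) y b w)) t
      = fderiv ℝ (fun z => christoffelFirst (ofForm B) z b w t) y a
        - B y (christoffel (ofForm B) y b w) (christoffel (ofForm B) y a t) := by
    intro a b w t
    have h1 := fderiv_ofForm_moving hd (differentiableAt_christoffel (G := ofForm B) hB hdet b w) a t
    rw [fderiv_ofForm_eq_christoffel hd hs hdet] at h1
    have h2 : (fun z => B z (christoffel (ofForm B) z b w) t)
        =ᶠ[nhds y] fun z => christoffelFirst (ofForm B) z b w t := by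
      filter_upwards [hdet', hd'] with z hz hdz
      exact ofForm_christoffel hdz (hs z) hz b w t
    rw [h2.fderiv_eq] at h1
    rw [h1, map_add, LinearMap.add_apply]
    ring
  have hc1 : ∀ b w t : Euc n,
      DifferentiableAt ℝ (fun z => christoffelFirst (ofForm B) z b w t) y := fun b w t =>
    (((differentiableAt_fderiv_apply (hB _ _) _).add
      (differentiableAt_fderiv_apply (hB _ _) _)).sub
      (differentiableAt_fderiv_apply (hB _ _) _)).const_mul _
  -- The part symmetric in `w` and `t` is a second derivative of the metric itself.
  have hsum : ∀ a b : Euc n, fderiv ℝ (fun z => christoffelFirst (ofForm B) z b w t) y a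
      + fderiv ℝ (fun z => christoffelFirst (ofForm B) z b t w) y a
      = fderiv ℝ (fderiv ℝ fun z => B z w t) y a b := by
    intro a b
    have h := fderiv_fun_add (hc1 b w t) (hc1 b t w)
    simp only [christoffelFirst_add_swap hs] at h
    have h' := congrArg (fun L => L a) h
    simp only [add_apply] at h'
    rw [← h', fderiv_clm_apply (((hB w t).fderiv_right (m := 1) (by norm_num)).differentiableAt
      one_ne_zero) (differentiableAt_const b)]
    simp
  have hsym : fderiv ℝ (fderiv ℝ fun z => B z w t) y u v
      = fderiv ℝ (fderiv ℝ fun z => B z w t) y v u :=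
    (hB w t).isSymmSndFDerivAt (by simp) u v
  rw [curvature_eq _ _ _ _ (christoffel_zero_left y w),
    curvature_eq _ _ _ _ (christoffel_zero_left y t)]
  simp only [map_sub, LinearMap.sub_apply, key]
  -- In the sum over `(w, t)` and `(t, w)` the products of Christoffel symbols cancel in pairs and
  -- the second derivatives cancel by `hsym`.
  have e1 := hsum u v
  have e2 := hsum v u
  rw [hs y (christoffel (ofForm B) y v t), hs y (christoffel (ofForm B) y u t)]
  linarith

end CoordMetric

/-! ### Traces in orthonormal frames -/

namespace CoordMetric

variable {n : ℕ}

theorem span_range_eq_top_of_orthonormal {b : LinearMap.BilinForm ℝ (Euc n)} {X : Fin n → Euc n}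
    (hX : ∀ i j, b (X i) (X j) = if i = j then 1 else 0) :
    Submodule.span ℝ (Set.range X) = ⊤ := by
  have hli : LinearIndependent ℝ X := by
    rw [Fintype.linearIndependent_iff]
    intro c hc j
    have h := congrArg (fun v => b v (X j)) hc
    simpa [hX] using h
  exact hli.span_eq_top_of_card_eq_finrank' (by simp)

theorem gram_mul_frame {G : Euc n → Euc n → Euc n → ℝ} {y : Euc n}
    {b : LinearMap.BilinForm ℝ (Euc n)} (hb : ∀ u v, G y u v = b u v) {X : Fin n → Euc n}
    (hX : ∀ i j, b (X i) (X j) = if i = j then 1 else 0) :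
    (Matrix.of fun a i => X a i) * gram G y * (Matrix.of fun i a => X a i) = 1 := by
  ext i j
  rw [Matrix.one_apply, ← hX i j, bilin_eq_sum b (X i), Matrix.mul_assoc, Matrix.mul_apply]
  refine Finset.sum_congr rfl fun k _ => ?_
  rw [apply_eq_sum (b (coordVec k)) (X j), Matrix.mul_apply]
  simp [gram, hb, mul_comm]

theorem gram_det_ne_zero_of_orthonormal {G : Euc n → Euc n → Euc n → ℝ} {y : Euc n}
    {b : LinearMap.BilinForm ℝ (Euc n)} (hb : ∀ u v, G y u v = b u v) {X : Fin n → Euc n}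
    (hX : ∀ i j, b (X i) (X j) = if i = j then 1 else 0) : (gram G y).det ≠ 0 := by
  intro h
  have := congrArg Matrix.det (gram_mul_frame hb hX)
  simp [Matrix.det_mul, h] at this

/-- The inverse metric in terms of an orthonormal frame. -/
theorem gramInv_eq_sum {G : Euc n → Euc n → Euc n → ℝ} {y : Euc n}
    {b : LinearMap.BilinForm ℝ (Euc n)} (hb : ∀ u v, G y u v = b u v) {X : Fin n → Euc n}
    (hX : ∀ i j, b (X i) (X j) = if i = j then 1 else 0) (i j : Fin n) :
    gramInv G y i j = ∑ a, X a i * X a j := by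
  have h1 := mul_eq_one_comm.1 (gram_mul_frame hb hX)
  rw [← Matrix.mul_assoc] at h1
  rw [gramInv, Matrix.inv_eq_left_inv h1, Matrix.mul_apply]
  rfl

/-- The metric trace of a bilinear map may be computed in any orthonormal frame. -/
theorem sum_gramInv_smul {V : Type*} [AddCommGroup V] [Module ℝ V]
    {G : Euc n → Euc n → Euc n → ℝ} {y : Euc n}
    {b : LinearMap.BilinForm ℝ (Euc n)} (hb : ∀ u v, G y u v = b u v) {X : Fin n → Euc n}
    (hX : ∀ i j, b (X i) (X j) = if i = j then 1 else 0) (T : Euc n →ₗ[ℝ] Euc n →ₗ[ℝ] V) :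
    ∑ i, ∑ j, gramInv G y i j • T (coordVec i) (coordVec j) = ∑ a, T (X a) (X a) := by
  have h : ∀ a, T (X a) (X a) = ∑ i, ∑ j, (X a i * X a j) • T (coordVec i) (coordVec j) := by
    intro a
    rw [apply_eq_sum T (X a), LinearMap.sum_apply]
    refine Finset.sum_congr rfl fun i _ => ?_
    rw [LinearMap.smul_apply, apply_eq_sum (T (coordVec i)) (X a), Finset.smul_sum]
    exact Finset.sum_congr rfl fun j _ => smul_smul _ _ _
  simp only [h, gramInv_eq_sum hb hX, Finset.sum_smul]
  symm
  rw [Finset.sum_comm]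
  exact Finset.sum_congr rfl fun i _ => Finset.sum_comm

end CoordMetric

/-! ### The second fundamental form and the smoothness of the Moebius metric -/

namespace ParamImmersion

open CoordMetric

variable {n m : ℕ}

/-- The induced metric at a point as a bilinear form. -/
def metricForm (F : Euc n → Euc m) (y : Euc n) : LinearMap.BilinForm ℝ (Euc n) :=
  (innerₗ (Euc m)).compl₁₂ (fderiv ℝ F y).toLinearMap (fderiv ℝ F y).toLinearMap

theorem metricForm_apply (F : Euc n → Euc m) (y u v : Euc n) :
    metricForm F y u v = metric F y u v := rfl

theorem metric_comm (F : Euc n → Euc m) (y u v : Euc n) : metric F y u v = metric F y v u :=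
  real_inner_comm _ _

theorem metric_self_pos {F : Euc n → Euc m} {y : Euc n}
    (hinj : Function.Injective (fderiv ℝ F y)) {u : Euc n} (hu : u ≠ 0) : 0 < metric F y u u :=
  real_inner_self_pos.2 ((map_ne_zero_iff _ hinj).2 hu)

/-- The second fundamental form at a point as a bilinear map. -/
def sffForm (F : Euc n → Euc m) (y : Euc n) : Euc n →ₗ[ℝ] Euc n →ₗ[ℝ] Euc m :=
  (((ContinuousLinearMap.compL ℝ (Euc n) (Euc m) (Euc m) (normalProj F y)).comp
    (fderiv ℝ (fderiv ℝ F) y)).toLinearMap₁₂)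

theorem two_le_infty : (2 : WithTop ℕ∞) ≤ ∞ :=
  WithTop.coe_le_coe.2 (le_top : (2 : ℕ∞) ≤ ⊤)

theorem differentiableAt_fderiv {F : Euc n → Euc m} {y : Euc n} (hF : ContDiffAt ℝ ∞ F y) :
    DifferentiableAt ℝ (fderiv ℝ F) y :=
  ((hF.of_le two_le_infty).fderiv_right (m := 1) (by norm_num)).differentiableAt one_ne_zero

theorem sff_eq {F : Euc n → Euc m} {y : Euc n} (hF : ContDiffAt ℝ ∞ F y) (u v : Euc n) :
    sff F y u v = normalProj F y (fderiv ℝ (fderiv ℝ F) y u v) := by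
  rw [sff, fderiv_clm_apply (differentiableAt_fderiv hF) (differentiableAt_const v)]
  simp

theorem sffForm_apply {F : Euc n → Euc m} {y : Euc n} (hF : ContDiffAt ℝ ∞ F y) (u v : Euc n) :
    sffForm F y u v = sff F y u v := by
  rw [sff_eq hF]
  rfl

theorem sff_comm {F : Euc n → Euc m} {y : Euc n} (hF : ContDiffAt ℝ ∞ F y) (u v : Euc n) :
    sff F y u v = sff F y v u := by
  rw [sff_eq hF, sff_eq hF, hF.isSymmSndFDerivAt (by simpa using two_le_infty) u v]

theorem sff_mem_normalSpace (F : Euc n → Euc m) (y u v : Euc n) :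
    sff F y u v ∈ normalSpace F y :=
  Submodule.starProjection_apply_mem _ _

theorem meanCurvature_mem_normalSpace (F : Euc n → Euc m) (y : Euc n) :
    meanCurvature F y ∈ normalSpace F y :=
  Submodule.smul_mem _ _ <| Submodule.sum_mem _ fun _ _ => Submodule.sum_mem _ fun _ _ =>
    Submodule.smul_mem _ _ (sff_mem_normalSpace F y _ _)

theorem moebiusSff_mem_normalSpace (F : Euc n → Euc m) (y u v : Euc n) :
    moebiusSff F y u v ∈ normalSpace F y :=
  Submodule.smul_mem _ _ <| Submodule.sub_mem _ (sff_mem_normalSpace F y u v)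
    (Submodule.smul_mem _ _ (meanCurvature_mem_normalSpace F y))

/-- The normal projection in coordinates: the tangential part is removed with the help of the
inverse metric. -/
theorem normalProj_eq {F : Euc n → Euc m} {y : Euc n} (hdet : (gram (metric F) y).det ≠ 0)
    (ξ : Euc m) :
    normalProj F y ξ = ξ - ∑ k, ∑ l, (gramInv (metric F) y k l *
      inner ℝ ξ (fderiv ℝ F y (coordVec l))) • fderiv ℝ F y (coordVec k) := by
  have h0 : normalProj F y ξ
      = ξ - (LinearMap.range (fderiv ℝ F y).toLinearMap).starProjection ξ :=
    Submodule.starProjection_orthogonal_val ξ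
  rw [h0]
  congr 1
  set T := ∑ k, ∑ l, (gramInv (metric F) y k l *
      inner ℝ ξ (fderiv ℝ F y (coordVec l))) • fderiv ℝ F y (coordVec k) with hT
  refine Submodule.eq_starProjection_of_mem_orthogonal' (z := ξ - T) ?_ ?_ (by abel)
  · exact Submodule.sum_mem _ fun k _ => Submodule.sum_mem _ fun l _ =>
      Submodule.smul_mem _ _ ⟨coordVec k, rfl⟩
  have hbasis : ∀ j, inner ℝ (fderiv ℝ F y (coordVec j)) (ξ - T) = 0 := by
    intro j
    have hmul : ∀ l, ∑ k, inner ℝ (fderiv ℝ F y (coordVec j)) (fderiv ℝ F y (coordVec k))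
        * gramInv (metric F) y k l = if j = l then 1 else 0 := by
      intro l
      have h := congrFun (congrFun (Matrix.mul_nonsing_inv _ (isUnit_iff_ne_zero.2 hdet)) j) l
      rw [Matrix.mul_apply, Matrix.one_apply] at h
      exact h
    have hTj : inner ℝ (fderiv ℝ F y (coordVec j)) T
        = inner ℝ ξ (fderiv ℝ F y (coordVec j)) := by
      simp only [hT, inner_sum, inner_smul_right]
      rw [Finset.sum_comm]
      calc _ = ∑ l, (if j = l then 1 else 0) * inner ℝ ξ (fderiv ℝ F y (coordVec l)) := by
            refine Finset.sum_congr rfl fun l _ => ?_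
            rw [← hmul l, Finset.sum_mul]
            exact Finset.sum_congr rfl fun k _ => by ring
        _ = _ := by simp
    rw [inner_sub_right, hTj, real_inner_comm, sub_self]
  rw [Submodule.mem_orthogonal]
  rintro _ ⟨w, rfl⟩
  have h := apply_eq_sum (fderiv ℝ F y).toLinearMap w
  rw [h, sum_inner]
  refine Finset.sum_eq_zero fun k _ => ?_
  rw [inner_smul_left, ContinuousLinearMap.coe_coe, hbasis k, mul_zero]

theorem contDiffAt_fderiv_apply {F : Euc n → Euc m} {y : Euc n} (hF : ContDiffAt ℝ ∞ F y)
    (u : Euc n) : ContDiffAt ℝ ∞ (fun z => fderiv ℝ F z u) y :=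
  (hF.fderiv_right (m := ∞) le_rfl).clm_apply contDiffAt_const

theorem contDiffAt_metric {F : Euc n → Euc m} {y : Euc n} (hF : ContDiffAt ℝ ∞ F y)
    (u v : Euc n) : ContDiffAt ℝ ∞ (fun z => metric F z u v) y :=
  (contDiffAt_fderiv_apply hF u).inner ℝ (contDiffAt_fderiv_apply hF v)

section Smooth

variable {F : Euc n → Euc m} {y : Euc n}

/-- The normal projection is smooth because near `y` it is given by `normalProj_eq`. -/
theorem contDiffAt_sff (hF : ContDiffAt ℝ ∞ F y)
    (hdet : (gram (metric F) y).det ≠ 0) (u v : Euc n) :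
    ContDiffAt ℝ ∞ (fun z => sff F z u v) y := by
  have hev : ∀ᶠ z in nhds y, (gram (metric F) z).det ≠ 0 :=
    (contDiffAt_gram_det (contDiffAt_metric hF)).continuousAt.eventually_ne hdet
  have hT : ContDiffAt ℝ ∞ (fun z => fderiv ℝ (fun z => fderiv ℝ F z v) z u) y :=
    contDiffAt_fderiv_apply (contDiffAt_fderiv_apply hF v) u
  refine ContDiffAt.congr_of_eventuallyEq ?_ (hev.mono fun z hz => normalProj_eq hz _)
  refine hT.sub (ContDiffAt.sum fun k _ => ContDiffAt.sum fun l _ => ?_)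
  exact ((contDiffAt_gramInv (contDiffAt_metric hF) hdet k l).mul
    (hT.inner ℝ (contDiffAt_fderiv_apply hF _))).smul (contDiffAt_fderiv_apply hF _)

theorem contDiffAt_meanCurvature (hF : ContDiffAt ℝ ∞ F y)
    (hdet : (gram (metric F) y).det ≠ 0) : ContDiffAt ℝ ∞ (meanCurvature F) y :=
  ContDiffAt.const_smul _ <| ContDiffAt.sum fun i _ => ContDiffAt.sum fun j _ =>
    (contDiffAt_gramInv (contDiffAt_metric hF) hdet i j).smul (contDiffAt_sff hF hdet _ _)

theorem contDiffAt_sffNormSq (hF : ContDiffAt ℝ ∞ F y)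
    (hdet : (gram (metric F) y).det ≠ 0) : ContDiffAt ℝ ∞ (sffNormSq F) y :=
  ContDiffAt.sum fun i _ => ContDiffAt.sum fun j _ => ContDiffAt.sum fun k _ =>
    ContDiffAt.sum fun l _ =>
      ((contDiffAt_gramInv (contDiffAt_metric hF) hdet i k).mul
        (contDiffAt_gramInv (contDiffAt_metric hF) hdet j l)).mul
      ((contDiffAt_sff hF hdet _ _).inner ℝ (contDiffAt_sff hF hdet _ _))

/-- Where `ρ` is positive the square root in its definition is smooth. -/
theorem contDiffAt_moebiusMetric (hF : ContDiffAt ℝ ∞ F y)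
    (hdet : (gram (metric F) y).det ≠ 0) (hρ : 0 < rho F y)
    (u v : Euc n) :
    ContDiffAt ℝ ∞ (fun z => moebiusMetric F z u v) y := by
  have hc : ContDiffAt ℝ ∞
      (fun z => (n : ℝ) / ((n : ℝ) - 1) * (sffNormSq F z - n * ‖meanCurvature F z‖ ^ 2)) y :=
    contDiffAt_const.mul ((contDiffAt_sffNormSq hF hdet).sub
      (contDiffAt_const.mul ((contDiffAt_meanCurvature hF hdet).norm_sq ℝ)))
  exact ((hc.sqrt (Real.sqrt_pos.1 hρ).ne').pow 2).mul (contDiffAt_metric hF u v)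

end Smooth

section Frame

variable {F : Euc n → Euc m} {y : Euc n} {X : Fin n → Euc n}

theorem meanCurvature_eq_sum (hF : ContDiffAt ℝ ∞ F y)
    (hX : ∀ i j, metric F y (X i) (X j) = if i = j then 1 else 0) :
    meanCurvature F y = (1 / (n : ℝ)) • ∑ a, sff F y (X a) (X a) := by
  have h := sum_gramInv_smul (G := metric F) (fun u v => (metricForm_apply F y u v).symm) hX
    (sffForm F y)
  simp only [sffForm_apply hF] at h
  rw [meanCurvature, h]

theorem sffNormSq_eq_sum (hF : ContDiffAt ℝ ∞ F y)
    (hX : ∀ i j, metric F y (X i) (X j) = if i = j then 1 else 0) :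
    sffNormSq F y = ∑ a, ∑ b, ‖sff F y (X a) (X b)‖ ^ 2 := by
  have tr := fun T : LinearMap.BilinForm ℝ (Euc n) =>
    sum_gramInv_smul (G := metric F) (fun u v => (metricForm_apply F y u v).symm) hX T
  have h1 : ∀ i k, ∑ j, ∑ l, gramInv (metric F) y j l *
      inner ℝ (sff F y (coordVec i) (coordVec j)) (sff F y (coordVec k) (coordVec l))
      = ∑ b, inner ℝ (sff F y (coordVec i) (X b)) (sff F y (coordVec k) (X b)) := by
    intro i k
    simpa [sffForm_apply hF] using
      tr ((innerₗ (Euc m)).compl₁₂ (sffForm F y (coordVec i)) (sffForm F y (coordVec k)))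
  have h2 : ∀ b, ∑ i, ∑ k, gramInv (metric F) y i k *
      inner ℝ (sff F y (coordVec i) (X b)) (sff F y (coordVec k) (X b))
      = ∑ a, ‖sff F y (X a) (X b)‖ ^ 2 := by
    intro b
    simpa [sffForm_apply hF] using
      tr ((innerₗ (Euc m)).compl₁₂ ((sffForm F y).flip (X b)) ((sffForm F y).flip (X b)))
  calc sffNormSq F y
      = ∑ i, ∑ k, gramInv (metric F) y i k * ∑ j, ∑ l, gramInv (metric F) y j l *
          inner ℝ (sff F y (coordVec i) (coordVec j)) (sff F y (coordVec k) (coordVec l)) := by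
        refine Finset.sum_congr rfl fun i _ => ?_
        rw [Finset.sum_comm]
        simp only [Finset.mul_sum, mul_assoc]
    _ = ∑ b, ∑ i, ∑ k, gramInv (metric F) y i k *
          inner ℝ (sff F y (coordVec i) (X b)) (sff F y (coordVec k) (X b)) := by
        simp only [h1, Finset.mul_sum]
        symm
        rw [Finset.sum_comm]
        exact Finset.sum_congr rfl fun i _ => Finset.sum_comm
    _ = _ := by
        simp only [h2]
        exact Finset.sum_comm

/-- `‖α‖² - n ‖H‖²` is the squared norm of the traceless part `α - ⟨·, ·⟩ H`. -/
theorem sffNormSq_sub_eq_sum (hn : n ≠ 0) (hF : ContDiffAt ℝ ∞ F y)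
    (hX : ∀ i j, metric F y (X i) (X j) = if i = j then 1 else 0) :
    sffNormSq F y - n * ‖meanCurvature F y‖ ^ 2
      = ∑ a, ∑ b, ‖sff F y (X a) (X b) - metric F y (X a) (X b) • meanCurvature F y‖ ^ 2 := by
  have htr : ∑ a, sff F y (X a) (X a) = (n : ℝ) • meanCurvature F y := by
    rw [meanCurvature_eq_sum hF hX, smul_smul, mul_one_div_cancel (by exact_mod_cast hn), one_smul]
  have hin : ∑ a, inner ℝ (sff F y (X a) (X a)) (meanCurvature F y)
      = n * ‖meanCurvature F y‖ ^ 2 := by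
    rw [← sum_inner, htr, inner_smul_left, real_inner_self_eq_norm_sq]
    simp
  have hab : ∀ a b, ‖sff F y (X a) (X b) - metric F y (X a) (X b) • meanCurvature F y‖ ^ 2
      = ‖sff F y (X a) (X b)‖ ^ 2 + if a = b then
        (‖meanCurvature F y‖ ^ 2 - 2 * inner ℝ (sff F y (X a) (X a)) (meanCurvature F y)) else 0 := by
    intro a b
    rw [hX]
    split_ifs with h
    · subst h
      rw [one_smul, norm_sub_sq_real]
      ring
    · simp
  simp only [hab, Finset.sum_add_distrib, Finset.sum_ite_eq, Finset.mem_univ, if_true,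
    Finset.sum_sub_distrib, ← Finset.mul_sum, hin, ← sffNormSq_eq_sum hF hX]
  simp
  ring

theorem rho_pos (hn : 2 ≤ n) (hF : ContDiffAt ℝ ∞ F y)
    (hX : ∀ i j, metric F y (X i) (X j) = if i = j then 1 else 0)
    (humb : ¬ ∀ u v, sff F y u v = metric F y u v • meanCurvature F y) : 0 < rho F y := by
  have hn1 : (0 : ℝ) < n - 1 := by
    have : (2 : ℝ) ≤ n := by exact_mod_cast hn
    linarith
  refine Real.sqrt_pos.2 (mul_pos (div_pos (by linarith) hn1) ?_)
  rw [sffNormSq_sub_eq_sum (by omega) hF hX]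
  refine lt_of_le_of_ne (by positivity) fun h => humb ?_
  have hz : ∀ a b, sff F y (X a) (X b) = metric F y (X a) (X b) • meanCurvature F y := by
    intro a b
    have h1 := (Finset.sum_eq_zero_iff_of_nonneg fun a _ => by positivity).1 h.symm a
      (Finset.mem_univ a)
    have h2 := (Finset.sum_eq_zero_iff_of_nonneg fun b _ => by positivity).1 h1 b
      (Finset.mem_univ b)
    exact sub_eq_zero.1 (norm_eq_zero.1 (pow_eq_zero_iff two_ne_zero |>.1 h2))
  have hspan := span_range_eq_top_of_orthonormal (b := metricForm F y) hX
  have hform : sffForm F y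
      = (metricForm F y).compr₂ (LinearMap.toSpanSingleton ℝ (Euc m) (meanCurvature F y)) := by
    refine LinearMap.ext_on_range hspan fun a => LinearMap.ext_on_range hspan fun b => ?_
    rw [sffForm_apply hF, hz]
    rfl
  intro u v
  rw [← sffForm_apply hF, hform]
  rfl

end Frame

end ParamImmersion

/-! ### Principal frames and the vanishing of the curvature -/

namespace ParamImmersion

open CoordMetric

variable {n m : ℕ}

/-- Principal vectors of distinct principal normals are orthogonal, so after normalization `n` of
them form an orthonormal frame. -/
theorem exists_orthonormal_principal {F : Euc n → Euc m} {y : Euc n} (hF : ContDiffAt ℝ ∞ F y)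
    (hinj : Function.Injective (fderiv ℝ F y)) {η : Fin n → Euc m}
    (hη : ∀ i j, i ≠ j → η i ≠ η j)
    (hprin : ∀ i, ∃ u, u ≠ 0 ∧ ∀ v, sff F y u v = metric F y u v • η i) :
    ∃ X : Fin n → Euc n, (∀ i j, metric F y (X i) (X j) = if i = j then 1 else 0) ∧
      ∀ i v, sff F y (X i) v = metric F y (X i) v • η i := by
  choose U hU0 hU using hprin
  have hpos := fun i => metric_self_pos hinj (hU0 i)
  have horth : ∀ i j, i ≠ j → metric F y (U i) (U j) = 0 := by
    intro i j hij
    -- Both principal vectors evaluate `α(Uᵢ, Uⱼ)`.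
    have h1 := hU i (U j)
    rw [sff_comm hF, hU j (U i), metric_comm F y (U j) (U i), ← sub_eq_zero, ← smul_sub] at h1
    exact (smul_eq_zero.1 h1).resolve_right (sub_ne_zero.2 (hη j i hij.symm))
  have hsmul : ∀ (c : ℝ) u v, metric F y (c • u) v = c * metric F y u v := by
    intro c u v
    simp [← metricForm_apply]
  refine ⟨fun i => (Real.sqrt (metric F y (U i) (U i)))⁻¹ • U i, fun i j => ?_, fun i v => ?_⟩
  · dsimp only
    rw [hsmul, metric_comm F y (U i) (_ • U j), hsmul]
    split_ifs with h
    · subst h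
      have hs := Real.sqrt_pos.2 (hpos i)
      field_simp
      exact (Real.sq_sqrt (hpos i).le).symm
    · rw [horth j i (Ne.symm h), mul_zero, mul_zero]
  · rw [hsmul, mul_smul, ← hU, ← sffForm_apply hF, ← sffForm_apply hF, map_smul,
      LinearMap.smul_apply]

/-- The Moebius metric at a point as a bilinear form. -/
def moebiusForm (F : Euc n → Euc m) (y : Euc n) : LinearMap.BilinForm ℝ (Euc n) :=
  rho F y ^ 2 • metricForm F y

theorem moebiusForm_apply (F : Euc n → Euc m) (y u v : Euc n) :
    moebiusForm F y u v = moebiusMetric F y u v := rfl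

/-- `curvature_skew` for the Moebius metric. It asks for smoothness at `y` only, so nothing is needed
about `ρ` away from `y`. -/
theorem moebiusMetric_curvature_skew {F : Euc n → Euc m} {y : Euc n}
    (hF : ContDiffAt ℝ ∞ F y) (hdet : (gram (metric F) y).det ≠ 0) (hρ : 0 < rho F y)
    (u v w t : Euc n) :
    moebiusMetric F y (curvature (moebiusMetric F) y u v w) t
      = -moebiusMetric F y (curvature (moebiusMetric F) y u v t) w := by
  have hdet' : (gram (moebiusMetric F) y).det ≠ 0 := by
    have h : gram (moebiusMetric F) y = rho F y ^ 2 • gram (metric F) y := rfl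
    rw [h, Matrix.det_smul]
    exact mul_ne_zero (pow_ne_zero _ (pow_ne_zero _ hρ.ne')) hdet
  refine curvature_skew (B := moebiusForm F)
    (fun v w => (contDiffAt_moebiusMetric hF hdet hρ v w).of_le two_le_infty) ?_ hdet' u v w t
  intro z v w
  rw [moebiusForm_apply, moebiusForm_apply, moebiusMetric, moebiusMetric, metric_comm]

/-- If an endomorphism `A`, skew for the metric, acts as a derivation annihilating the traceless
second fundamental form, then `A` vanishes: on a pair of principal vectors the derivation identity
reads `⟨A Xᵢ, Xⱼ⟩ (ηⱼ - ηᵢ) = 0`. Linearity of `A` is implied by skewness. -/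
theorem metric_eq_zero_of_skew_of_derivation {F : Euc n → Euc m} {y : Euc n}
    (hF : ContDiffAt ℝ ∞ F y) {η : Fin n → Euc m} (hη : ∀ i j, i ≠ j → η i ≠ η j)
    {X : Fin n → Euc n} (hX : ∀ i j, metric F y (X i) (X j) = if i = j then 1 else 0)
    (hprin : ∀ i v, sff F y (X i) v = metric F y (X i) v • η i) (hρ : 0 < rho F y)
    {A : Euc n → Euc n} (hskew : ∀ w t, metric F y (A w) t = -metric F y (A t) w)
    (hder : ∀ z w, moebiusSff F y (A z) w + moebiusSff F y z (A w) = 0) (w t : Euc n) :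
    metric F y (A w) t = 0 := by
  have hXX : ∀ i j, metric F y (A (X i)) (X j) = 0 := by
    intro i j
    by_cases hij : i = j
    · subst hij
      linarith [hskew (X i) (X i)]
    have h := hder (X i) (X j)
    rw [moebiusSff, moebiusSff, sff_comm hF (A (X i)), hprin, hprin, ← smul_add,
      smul_eq_zero_iff_right hρ.ne', metric_comm F y (X j), metric_comm F y (X i) (A _),
      hskew (X j) (X i)] at h
    have h' : metric F y (A (X i)) (X j) • (η j - η i) = 0 := by
      rw [← h]
      module
    exact (smul_eq_zero.1 h').resolve_right (sub_ne_zero.2 (hη j i (Ne.symm hij)))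
  have hspan := span_range_eq_top_of_orthonormal (b := metricForm F y) hX
  have hext : ∀ w, (∀ j, metric F y (A w) (X j) = 0) → ∀ t, metric F y (A w) t = 0 := by
    intro w hw t
    have h : metricForm F y (A w) = 0 := LinearMap.ext_on_range hspan hw
    rw [← metricForm_apply, h, LinearMap.zero_apply]
  -- First extend from the frame in the second slot, then swap the slots by skewness.
  refine hext w (fun j => ?_) t
  rw [hskew, hext (X j) (hXX j), neg_zero]

end ParamImmersion

/-! ### Immersions of manifolds read in a chart -/

namespace MoebiusSubmanifold

open ParamImmersion

variable {n m : ℕ} {M : Type*} [TopologicalSpace M] [ChartedSpace (Euc n) M]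

theorem IsSmoothImmersion.contDiffAt_localRep {f : M → Euc m}
    (hf : IsSmoothImmersion (n := n) f) (x : M) :
    ContDiffAt ℝ ∞ (localRep (n := n) f x) (center x) := by
  have h := (contMDiffAt_iff.1 (hf.1 x)).2
  rw [modelWithCornersSelf_coe, Set.range_id, contDiffWithinAt_univ,
    extChartAt_model_space_eq_id] at h
  exact h

theorem IsSmoothImmersion.injective_fderiv_localRep {f : M → Euc m}
    (hf : IsSmoothImmersion (n := n) f) (x : M) :
    Function.Injective (fderiv ℝ (localRep (n := n) f x) (center x)) := by
  have h := hf.2 x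
  rw [((hf.1 x).mdifferentiableAt (by simp)).mfderiv] at h
  rw [modelWithCornersSelf_coe, Set.range_id, fderivWithin_univ, writtenInExtChartAt,
    extChartAt_model_space_eq_id] at h
  exact h

end MoebiusSubmanifold
end

theorem theorem1p2 (n p : ℕ) (hn : 2 ≤ n) (hp : 2 ≤ p)
    (M : Type*) [TopologicalSpace M] [T2Space M] [SecondCountableTopology M]
    [ChartedSpace (Euc n) M] [IsManifold (𝓡 n) ∞ M]
    (f : M → Euc (n + p))
    (hf : MoebiusSubmanifold.IsSmoothImmersion (n := n) f)
    (humb : MoebiusSubmanifold.UmbilicFree n f)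
    (hflat : MoebiusSubmanifold.HasFlatNormalBundle n f)
    (hsemi : MoebiusSubmanifold.IsMoebiusSemiParallel n f)
    (hprin : MoebiusSubmanifold.HasDistinctPrincipalNormals n f n) :
    MoebiusSubmanifold.HasVanishingMoebiusCurvature n f := by
  intro x u v _
  obtain ⟨η, hη, hne⟩ := hprin
  have hF := hf.contDiffAt_localRep x
  obtain ⟨X, hX, hXη⟩ := ParamImmersion.exists_orthonormal_principal hF
    (hf.injective_fderiv_localRep x) (hne x) fun i => (hη i x).2
  have hdet := CoordMetric.gram_det_ne_zero_of_orthonormal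
    (fun u v => (ParamImmersion.metricForm_apply _ _ u v).symm) hX
  have hρ := ParamImmersion.rho_pos hn hF hX (humb x)
  have hcurv := ParamImmersion.metric_eq_zero_of_skew_of_derivation hF (hne x) hX hXη hρ
    (A := MoebiusSubmanifold.moebiusCurvature f x u v) (fun w t => ?_) (fun z w => ?_)
  · -- The numerator `⟨R*(u, v) v, u⟩*` vanishes.
    change _ / _ = (0 : ℝ)
    refine div_eq_zero_iff.2 (Or.inl ?_)
    exact mul_eq_zero_of_right _ (hcurv v u)
  · -- Skewness for the Moebius metric passes to the conformal induced metric.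
    have h := ParamImmersion.moebiusMetric_curvature_skew hF hdet hρ u v w t
    rw [ParamImmersion.moebiusMetric, ParamImmersion.moebiusMetric, ← mul_neg] at h
    exact mul_left_cancel₀ (pow_ne_zero 2 hρ.ne') h
  · -- The normal curvature term of semi-parallelism is zero, as `β(z, w)` is normal.
    have h := hsemi x u v z w
    rw [hflat x u v (MoebiusSubmanifold.moebiusSecondFundamentalForm f x z w)
      (ParamImmersion.moebiusSff_mem_normalSpace _ _ _ _), zero_sub, ← neg_add',
      neg_eq_zero] at h
    exact h
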